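/- Let $R$ be a finite associative ring, not necessarily having a multiplicative identity. Let $\widehat R$ be the multiplicative abelian group of all characters of $R$, that is, group homomorphisms $\pi:(R,+)\to\mathbb{C}^\times$. It is an $R$-bimodule, with scalar multiplications written ${}^r\pi$ (left) and $\pi^r$ (right) and given for $r,s\in R$ by ${}^r\pi(s)=\pi(sr)$ and $\pi^r(s)=\pi(rs)$. Suppose that there is a character $\chi\in\widehat R$ such that $r\mapsto\chi^r$ is an isomorphism $R\to\widehat R$ of right $R$-modules, or such that $r\mapsto{}^r\chi$ is an isomorphism $R\to\widehat R$ of left $R$-modules. Then $R$ has a two-sided multiplicative identity, and with this identity $R$ is a Frobenius ring: $R$ is left and right Artinian, $\operatorname{Soc}({}_RR)\cong R/\operatorname{rad}R$ as left $R$-modules, and $\operatorname{Soc}(R_R)\cong R/\operatorname{rad}R$ as right $R$-modules, where $\operatorname{Soc}$ denotes the socle (the sum of all simple submodules) and $\operatorname{rad}R$ the Jacobson radical of $R$. -/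

import Mathlib

namespace GenChar

/-! ### Characters of the additive group of a finite rng

`AddChar R ℂ` is the multiplicative group of homomorphisms from the additive group of `R` to the
multiplicative monoid of `ℂ`; as `R` is a group, the values are automatically in `ℂˣ`. -/

section Characters

variable {R : Type*} [NonUnitalRing R]

/-- The right scalar multiple `π ^ r` of a character: `⟨π ^ r, s⟩ = ⟨π, r * s⟩`. -/
def rightAct (π : AddChar R ℂ) (r : R) : AddChar R ℂ where
  toFun s := π (r * s)
  map_zero_eq_one' := by simp
  map_add_eq_mul' s t := by rw [mul_add, AddChar.map_add_eq_mul]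

/-- The left scalar multiple `ʳπ` of a character: `⟨ʳπ, s⟩ = ⟨π, s * r⟩`. -/
def leftAct (r : R) (π : AddChar R ℂ) : AddChar R ℂ where
  toFun s := π (s * r)
  map_zero_eq_one' := by simp
  map_add_eq_mul' s t := by rw [add_mul, AddChar.map_add_eq_mul]

/-- `f : R → R̂` is an isomorphism of right `R`-modules; the group `R̂` is written
multiplicatively. -/
structure IsRightModuleIso (f : R → AddChar R ℂ) : Prop where
  map_add : ∀ r s : R, f (r + s) = f r * f s
  map_act : ∀ r s : R, f (r * s) = rightAct (f r) s
  bijective : Function.Bijective f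

/-- `f : R → R̂` is an isomorphism of left `R`-modules; the group `R̂` is written
multiplicatively. -/
structure IsLeftModuleIso (f : R → AddChar R ℂ) : Prop where
  map_add : ∀ r s : R, f (r + s) = f r * f s
  map_act : ∀ r s : R, f (r * s) = leftAct r (f s)
  bijective : Function.Bijective f

/-- `e` is a two-sided multiplicative identity of the rng `R`. -/
def IsIdentity (e : R) : Prop :=
  ∀ r : R, e * r = r ∧ r * e = r

/-- The ring with underlying rng `R` and with `1 = e`, for an identity `e` of `R`. -/
abbrev ringOfIdentity (e : R) (he : IsIdentity e) : Ring R :=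
  { (inferInstance : NonUnitalRing R) with
    one := e
    one_mul := fun r => (he r).1
    mul_one := fun r => (he r).2 }

end Characters

/-! ### Frobenius rings -/

/-- The socle of a module: the sum of its minimal nonzero (that is, simple) submodules. -/
def socle (R M : Type*) [Ring R] [AddCommGroup M] [Module R M] : Submodule R M :=
  sSup {m : Submodule R M | IsAtom m}

/-- A ring with `1` is Frobenius if it is left and right Artinian, its left socle is isomorphic to
`R / rad R` as a left module, and its right socle is isomorphic to `R / rad R` as a right module.
Right `R`-modules are modules over `Rᵐᵒᵖ`; `Module.jacobson R R` (resp. `Module.jacobson Rᵐᵒᵖ R`) is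
the intersection of the maximal left (resp. right) ideals, and both are the Jacobson radical. -/
structure IsFrobeniusRing (R : Type*) [Ring R] : Prop where
  artinian_left : IsArtinian R R
  artinian_right : IsArtinian Rᵐᵒᵖ R
  socle_left : Nonempty (socle R R ≃ₗ[R] (R ⧸ Module.jacobson R R))
  socle_right : Nonempty (socle Rᵐᵒᵖ R ≃ₗ[Rᵐᵒᵖ] (R ⧸ Module.jacobson Rᵐᵒᵖ R))

end GenChar

/-! Either hypothesis makes the pairing `χ (r * s)` nondegenerate on one side. Since `R` has as many
characters as elements, every character is then a translate of `χ`; since characters separate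
points, the other side is nondegenerate too. Writing `χ` as its own translate by `e` yields the
identity. For the socle, the semisimple ring `R ⧸ Ring.jacobson R` carries a nondegenerate character
`θ` of its own (Wedderburn–Artin and traces). Its inflation to `R` is `s ↦ χ (s * c)`, and right
multiplication by `c` has kernel the radical and image the left socle. The right socle follows by
passing to the opposite ring. -/

namespace GenChar

section Nondegenerate

variable {R : Type*} [NonUnitalRing R]

/-- The kernel of the character `χ` contains no nonzero subset of the form `R * x`. -/
def IsLeftNondegenerate (χ : AddChar R ℂ) : Prop :=
  ∀ x : R, (∀ s : R, χ (s * x) = 1) → x = 0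

/-- The kernel of the character `χ` contains no nonzero subset of the form `x * R`. -/
def IsRightNondegenerate (χ : AddChar R ℂ) : Prop :=
  ∀ x : R, (∀ s : R, χ (x * s) = 1) → x = 0

/-- A left nondegenerate character of a finite rng generates all characters. -/
theorem IsLeftNondegenerate.exists_eq [Finite R] {χ : AddChar R ℂ}
    (h : IsLeftNondegenerate χ) (π : AddChar R ℂ) : ∃ c : R, ∀ s : R, π s = χ (s * c) := by
  have := Fintype.ofFinite R
  have inj : Function.Injective fun r : R => leftAct r χ := fun a b hab => by
    refine sub_eq_zero.1 (h _ fun s => ?_)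
    have hs : χ (s * a) = χ (s * b) := DFunLike.congr_fun hab s
    rw [mul_sub, AddChar.map_sub_eq_div, hs]
    exact div_self (χ.val_isUnit _).ne_zero
  obtain ⟨c, hc⟩ := ((Fintype.bijective_iff_injective_and_card _).2
    ⟨inj, AddChar.card_eq.symm⟩).2 π
  exact ⟨c, fun s => (DFunLike.congr_fun hc s).symm⟩

/-- A character of `R`, as a character of the opposite rng. -/
def opChar (χ : AddChar R ℂ) : AddChar Rᵐᵒᵖ ℂ :=
  χ.compAddMonoidHom (MulOpposite.opAddEquiv (α := R)).symm.toAddMonoidHom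

theorem IsRightNondegenerate.opChar {χ : AddChar R ℂ} (h : IsRightNondegenerate χ) :
    IsLeftNondegenerate (opChar χ) := fun x hx =>
  MulOpposite.unop_injective (h x.unop fun s => hx (MulOpposite.op s))

theorem IsRightNondegenerate.exists_eq [Finite R] {χ : AddChar R ℂ}
    (h : IsRightNondegenerate χ) (π : AddChar R ℂ) : ∃ c : R, ∀ s : R, π s = χ (c * s) := by
  have : Finite Rᵐᵒᵖ := .of_equiv R MulOpposite.opEquiv
  obtain ⟨c, hc⟩ := h.opChar.exists_eq (GenChar.opChar π)
  exact ⟨c.unop, fun s => hc (MulOpposite.op s)⟩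

/-- Every character is `s ↦ χ (s * c)` for some `c`, so an `x` with `χ (x * s) = 1` for all `s` is
killed by all characters. -/
theorem IsLeftNondegenerate.isRightNondegenerate [Finite R] {χ : AddChar R ℂ}
    (h : IsLeftNondegenerate χ) : IsRightNondegenerate χ := fun x hx =>
  AddChar.forall_apply_eq_zero.1 fun π => by
    obtain ⟨c, hc⟩ := h.exists_eq π
    rw [hc, hx]

theorem IsRightNondegenerate.isLeftNondegenerate [Finite R] {χ : AddChar R ℂ}
    (h : IsRightNondegenerate χ) : IsLeftNondegenerate χ := fun x hx =>
  AddChar.forall_apply_eq_zero.1 fun π => by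
    obtain ⟨c, hc⟩ := h.exists_eq π
    rw [hc, hx]

theorem IsLeftModuleIso.isLeftNondegenerate {χ : AddChar R ℂ}
    (h : IsLeftModuleIso fun r : R => leftAct r χ) : IsLeftNondegenerate χ := fun x hx =>
  h.bijective.1 <| by
    ext s
    change χ (s * x) = χ (s * 0)
    rw [hx, mul_zero, AddChar.map_zero_eq_one]

theorem IsRightModuleIso.isRightNondegenerate {χ : AddChar R ℂ}
    (h : IsRightModuleIso fun r : R => rightAct χ r) : IsRightNondegenerate χ := fun x hx =>
  h.bijective.1 <| by
    ext s
    change χ (x * s) = χ (0 * s)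
    rw [hx, zero_mul, AddChar.map_zero_eq_one]

theorem IsRightNondegenerate.exists_isIdentity [Finite R] {χ : AddChar R ℂ}
    (h : IsRightNondegenerate χ) : ∃ e : R, IsIdentity e := by
  obtain ⟨e, he⟩ := h.exists_eq χ
  have left (r : R) : e * r = r := by
    refine sub_eq_zero.1 (h _ fun s => ?_)
    rw [sub_mul, AddChar.map_sub_eq_div, mul_assoc, ← he]
    exact div_self (χ.val_isUnit _).ne_zero
  refine ⟨e, fun r => ⟨left r, sub_eq_zero.1 (h _ fun s => ?_)⟩⟩
  -- As `e` is a left identity, `(r * e - r) * s = 0`.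
  rw [sub_mul, mul_assoc, left, sub_self, AddChar.map_zero_eq_one]

end Nondegenerate

/-! ### Nondegenerate characters of finite semisimple rings -/

theorem exists_isLeftNondegenerate_of_divisionRing (D : Type*) [DivisionRing D] [Finite D] :
    ∃ θ : AddChar D ℂ, IsLeftNondegenerate θ := by
  obtain ⟨θ, hθ⟩ := AddChar.exists_apply_ne_zero.2 (one_ne_zero (α := D))
  refine ⟨θ, fun x hx => by_contra fun h0 => hθ ?_⟩
  simpa [h0] using hx x⁻¹

theorem exists_isLeftNondegenerate_matrix {D n : Type*} [Ring D] [Fintype n] [DecidableEq n]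
    (h : ∃ θ : AddChar D ℂ, IsLeftNondegenerate θ) :
    ∃ θ : AddChar (Matrix n n D) ℂ, IsLeftNondegenerate θ := by
  obtain ⟨θ, hθ⟩ := h
  -- Pairing `A` with `Matrix.single j i s` under the trace isolates `s * A i j`.
  refine ⟨θ.compAddMonoidHom (Matrix.traceAddMonoidHom n D), fun A hA => ?_⟩
  ext i j
  refine hθ _ fun s => ?_
  simpa [Matrix.trace_single_mul] using hA (Matrix.single j i s)

theorem exists_isLeftNondegenerate_pi {ι : Type*} [Fintype ι] {S : ι → Type*} [∀ i, Ring (S i)]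
    (h : ∀ i, ∃ θ : AddChar (S i) ℂ, IsLeftNondegenerate θ) :
    ∃ θ : AddChar (∀ i, S i) ℂ, IsLeftNondegenerate θ := by
  classical
  choose θ hθ using h
  refine ⟨∏ i, (θ i).compAddMonoidHom (Pi.evalAddMonoidHom S i), fun x hx => ?_⟩
  ext i
  refine hθ i _ fun s => ?_
  have := hx (Pi.single i s)
  rw [AddChar.prod_apply, Finset.prod_eq_single i] at this
  · simpa using this
  · intro j _ hj
    simp [hj]
  · simp

theorem IsLeftNondegenerate.comp_ringEquiv {S T : Type*} [Ring S] [Ring T] (e : S ≃+* T)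
    {θ : AddChar T ℂ} (h : IsLeftNondegenerate θ) :
    IsLeftNondegenerate (θ.compAddMonoidHom e.toAddEquiv.toAddMonoidHom) := fun x hx =>
  e.injective <| by
    rw [map_zero]
    exact h _ fun t => by simpa using hx (e.symm t)

theorem exists_isLeftNondegenerate_of_isSemisimpleRing (S : Type*) [Ring S] [Finite S]
    [IsSemisimpleRing S] : ∃ θ : AddChar S ℂ, IsLeftNondegenerate θ := by
  obtain ⟨n, D, d, _, hd, ⟨e⟩⟩ := IsSemisimpleRing.exists_ringEquiv_pi_matrix_divisionRing S
  have (i : Fin n) : Finite (D i) :=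
    -- The entry `0 0` exists because `hd` makes each `d i` nonzero.
    Finite.of_surjective (fun s : S => e s i 0 0) fun x =>
      ⟨e.symm (Pi.single i (Matrix.of fun _ _ => x)), by simp⟩
  obtain ⟨θ, hθ⟩ := exists_isLeftNondegenerate_pi fun i =>
    exists_isLeftNondegenerate_matrix (n := Fin (d i))
      (exists_isLeftNondegenerate_of_divisionRing (D i))
  exact ⟨_, hθ.comp_ringEquiv e⟩

/-! ### The socle -/

section Socle

variable {R M N : Type*} [Ring R] [AddCommGroup M] [Module R M] [AddCommGroup N] [Module R N]

theorem map_socle (e : M ≃ₗ[R] N) :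
    (socle R M).map (e : M →ₗ[R] N) = socle R N := by
  have key : Submodule.orderIsoMapComap e (socle R M) = socle R N := by
    rw [socle, socle, OrderIso.map_sSup, ← sSup_image]
    congr 1
    ext m
    constructor
    · rintro ⟨a, ha, rfl⟩
      exact (OrderIso.isAtom_iff _ _).2 ha
    · intro hm
      exact ⟨(Submodule.orderIsoMapComap e).symm m, (OrderIso.isAtom_iff _ _).2 hm,
        OrderIso.apply_symm_apply _ _⟩
  exact key

theorem le_socle_of_isSemisimpleModule (m : Submodule R M) [IsSemisimpleModule R m] :
    m ≤ socle R M := by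
  have top : Submodule.map m.subtype ⊤ = m := Submodule.map_subtype_top m
  rw [← top, ← IsSemisimpleModule.sSup_simples_eq_top R m, sSup_eq_iSup', Submodule.map_iSup]
  refine iSup_le fun ⟨a, ha⟩ => le_sSup (isSimpleModule_iff_isAtom.1 ?_)
  have : IsSimpleModule R a := ha
  exact .congr (Submodule.equivMapOfInjective m.subtype m.subtype_injective a).symm

theorem isSemisimpleModule_socle : IsSemisimpleModule R (socle R M) := by
  rw [socle, sSup_eq_iSup]
  refine isSemisimpleModule_biSup_of_isSemisimpleModule_submodule fun m hm => ?_
  have : IsSimpleModule R m := isSimpleModule_iff_isAtom.2 hm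
  infer_instance

theorem smul_eq_zero_of_mem_jacobson_of_mem_socle {j : R} (hj : j ∈ Ring.jacobson R) {x : M}
    (hx : x ∈ socle R M) : j • x = 0 := by
  have := isSemisimpleModule_socle (R := R) (M := M)
  have h := Module.mem_annihilator.1
    (IsSemisimpleModule.jacobson_le_annihilator R (socle R M) hj) ⟨x, hx⟩
  exact congrArg Subtype.val h

/-- A linear equivalence transports an isomorphism between the socle and the top. -/
theorem nonempty_socle_equiv_congr (e : M ≃ₗ[R] N)
    (h : Nonempty (socle R M ≃ₗ[R] M ⧸ Module.jacobson R M)) :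
    Nonempty (socle R N ≃ₗ[R] N ⧸ Module.jacobson R N) := by
  obtain ⟨f⟩ := h
  have hj : (Module.jacobson R M).map (e : M →ₗ[R] N) = Module.jacobson R N :=
    Module.map_jacobson_of_bijective e.bijective
  exact ⟨(LinearEquiv.ofEq _ _ (map_socle e).symm).trans <| (e.submoduleMap _).symm.trans <|
    f.trans <| Submodule.Quotient.equiv _ _ e hj⟩

end Socle

theorem IsLeftNondegenerate.nonempty_socle_equiv {R : Type*} [Ring R] [Finite R]
    {χ : AddChar R ℂ} (h : IsLeftNondegenerate χ) :
    Nonempty (socle R R ≃ₗ[R] R ⧸ Module.jacobson R R) := by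
  let q := Ideal.Quotient.mk (Ring.jacobson R)
  have hq : Function.Surjective q := Ideal.Quotient.mk_surjective
  have : Finite (R ⧸ Ring.jacobson R) := Finite.of_surjective q hq
  obtain ⟨θ, hθ⟩ := exists_isLeftNondegenerate_of_isSemisimpleRing (R ⧸ Ring.jacobson R)
  obtain ⟨c, hc⟩ := h.exists_eq (θ.compAddMonoidHom (q : R →+ R ⧸ Ring.jacobson R))
  replace hc (s : R) : θ (q s) = χ (s * c) := hc s
  let f : R →ₗ[R] R := LinearMap.toSpanSingleton R R c
  have hf (r : R) : f r = r * c := rfl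
  have ker : f.ker = Ring.jacobson R := by
    ext r
    rw [LinearMap.mem_ker, ← Ideal.Quotient.eq_zero_iff_mem, hf]
    refine ⟨fun hr => hθ _ (hq.forall.2 fun s => ?_), fun hr => h _ fun s => ?_⟩
    · change θ (q s * q r) = 1
      rw [← map_mul, hc, mul_assoc, hr, mul_zero, AddChar.map_zero_eq_one]
    · rw [← mul_assoc, ← hc, map_mul]
      change θ (q s * Ideal.Quotient.mk _ r) = 1
      rw [hr, mul_zero, AddChar.map_zero_eq_one]
  have ss : IsSemisimpleModule R (R ⧸ Ring.jacobson R) := by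
    -- The identity, semilinear along `q`, carries semisimplicity over the quotient ring to
    -- semisimplicity over `R`.
    let l : (R ⧸ Ring.jacobson R) →ₛₗ[q] (R ⧸ Ring.jacobson R) :=
      { AddMonoidHom.id _ with map_smul' := fun r => hq.forall.2 fun s => rfl }
    have : RingHomSurjective q := ⟨hq⟩
    exact (l.isSemisimpleModule_iff_of_bijective Function.bijective_id).2 inferInstance
  let E : (R ⧸ Ring.jacobson R) ≃ₗ[R] f.range :=
    (Submodule.quotEquivOfEq _ _ ker.symm).trans f.quotKerEquivRange
  have range : f.range = socle R R := by
    have : IsSemisimpleModule R f.range := .congr E.symm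
    refine le_antisymm (le_socle_of_isSemisimpleModule _) fun x hx => ?_
    -- The radical kills `x`, so `s ↦ χ (s * x)` descends to the quotient. There it is a translate
    -- of `θ` by some `q r`, which forces `x = r * c`.
    let π : AddChar (R ⧸ Ring.jacobson R) ℂ := AddChar.toAddMonoidHomEquiv.symm <|
      QuotientAddGroup.lift _ (AddChar.toAddMonoidHomEquiv (leftAct x χ)) fun j hj => by
        change χ (j * x) = 1
        rw [← smul_eq_mul, smul_eq_zero_of_mem_jacobson_of_mem_socle hj hx,
          AddChar.map_zero_eq_one]
    have hπ (s : R) : π (q s) = χ (s * x) := rfl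
    obtain ⟨r', hr⟩ := hθ.exists_eq π
    obtain ⟨r, rfl⟩ := hq r'
    refine ⟨r, sub_eq_zero.1 (h _ fun s => ?_)⟩
    rw [hf, mul_sub, AddChar.map_sub_eq_div, ← mul_assoc, ← hc, ← hπ, hr, map_mul]
    exact div_self (θ.val_isUnit _).ne_zero
  exact ⟨(LinearEquiv.ofEq _ _ range.symm).trans E.symm⟩

theorem IsLeftNondegenerate.isFrobeniusRing {R : Type*} [Ring R] [Finite R]
    {χ : AddChar R ℂ} (h : IsLeftNondegenerate χ) : IsFrobeniusRing R where
  artinian_left := inferInstance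
  artinian_right := inferInstance
  socle_left := h.nonempty_socle_equiv
  socle_right :=
    have : Finite Rᵐᵒᵖ := .of_equiv R MulOpposite.opEquiv
    let e : Rᵐᵒᵖ ≃ₗ[Rᵐᵒᵖ] R :=
      { MulOpposite.opAddEquiv.symm with map_smul' := fun _ _ => rfl }
    nonempty_socle_equiv_congr e h.isRightNondegenerate.opChar.nonempty_socle_equiv

end GenChar

theorem mainTheorem8 {R : Type*} [NonUnitalRing R] [Finite R]
    (h : ∃ χ : AddChar R ℂ,
      GenChar.IsRightModuleIso (fun r : R => GenChar.rightAct χ r) ∨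
      GenChar.IsLeftModuleIso (fun r : R => GenChar.leftAct r χ)) :
    ∃ (e : R) (he : GenChar.IsIdentity e),
      @GenChar.IsFrobeniusRing R (GenChar.ringOfIdentity e he) := by
  obtain ⟨χ, h⟩ := h
  have hr : GenChar.IsRightNondegenerate χ :=
    h.elim (·.isRightNondegenerate) (·.isLeftNondegenerate.isRightNondegenerate)
  obtain ⟨e, he⟩ := hr.exists_isIdentity
  let := GenChar.ringOfIdentity e he
  exact ⟨e, he, GenChar.IsLeftNondegenerate.isFrobeniusRing (χ := χ) hr.isLeftNondegenerate⟩
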